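/- Let $\mathcal{M}$ denote the ideal of first category (meagre) subsets of $\mathbb{R}$, and let $\mathrm{non}(\mathcal{M}) = \min\{\mathrm{card}\, S : S \subseteq \mathbb{R},\ S \notin \mathcal{M}\}$. Say that a set $S \subseteq \omega^\omega$ has property $(\ast)$ if for each $f : \omega \to \bigcup_{n \in \omega} \omega^n$ there exists a sequence $\{a_n\}_{n \in \omega}$ belonging to $S$ such that for infinitely many $i \in \omega$ the infinite sequence $\{a_{i+n}\}_{n \in \omega}$ extends the finite sequence $f(i)$. Then $\mathrm{non}(\mathcal{M})$ is the smallest cardinality of a family $S \subseteq \omega^\omega$ with property $(\ast)$; that is, some $S \subseteq \omega^\omega$ with property $(\ast)$ has cardinality $\mathrm{non}(\mathcal{M})$, and every $S \subseteq \omega^\omega$ with property $(\ast)$ has cardinality at least $\mathrm{non}(\mathcal{M})$. -/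

import Mathlib

open scoped Cardinal

/-- The infinite sequence `a` extends the finite sequence `s`, an element of
`⋃ n, X ^ n` given as its length `s.1` together with its entries `s.2`. -/
def ExtendsFin {X : Type*} (a : ℕ → X) (s : Σ n : ℕ, (Fin n → X)) : Prop :=
  ∀ k : Fin s.1, a k = s.2 k

/-- The property `(∗)` of a set `S` of infinite sequences: for each assignment `f` of a finite
sequence to every natural number, some `a ∈ S` is such that, for infinitely many `i`, the shifted
sequence `n ↦ a (i + n)` extends `f i`. -/
def PropertyStar {X : Type*} (S : Set (ℕ → X)) : Prop :=
  ∀ f : ℕ → (Σ n : ℕ, (Fin n → X)),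
    ∃ a ∈ S, {i : ℕ | ExtendsFin (fun n => a (i + n)) (f i)}.Infinite

/-- `non(M)`: the least cardinality of a set of reals that is not of first category. -/
noncomputable def nonM : Cardinal.{0} :=
  sInf {c : Cardinal.{0} | ∃ S : Set ℝ, ¬ IsMeagre S ∧ #S = c}

/-- The infimum in the definition of `nonM` is a minimum. -/
theorem nonM_isLeast :
    IsLeast {c : Cardinal.{0} | ∃ S : Set ℝ, ¬ IsMeagre S ∧ #S = c} nonM := by
  refine ⟨csInf_mem ⟨_, Set.univ, ?_, rfl⟩, fun c hc => csInf_le' hc⟩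
  exact not_isMeagre_of_isOpen isOpen_univ Set.univ_nonempty

/-! Sets are carried both ways by maps, which never raise cardinality. For fixed `f`, comeagrely
many `x` have `decodeReal x` matching `f` infinitely often, so a nonmeagre set decodes to one with
`(∗)`. Conversely, if dense open sets `U n` witnessed that `parityReal '' S` is meagre, let `f i` be
a word which, placed at position `i`, forces the real into `U 0 ∩ ... ∩ U i`
(`exists_forcing_word`); a sequence in `S` matching `f` infinitely often lands in every `U n`. -/

/-- The `j`-th binary digit of the real number `x`. -/
noncomputable def binDigit (x : ℝ) (j : ℕ) : ℤ := ⌊x * 2 ^ j⌋ % 2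

/-- The sequence of natural numbers coded by the binary digits of `x`: its `n`-th entry is the
position of the first digit `1` in the `n`-th row, with rows given by the pairing function. -/
noncomputable def decodeReal (x : ℝ) (n : ℕ) : ℕ := sInf {k | binDigit x (Nat.pair n k) = 1}

/-- The open dyadic interval `(p / 2 ^ m, (p + 1) / 2 ^ m)`. -/
def dyadicIoo (p : ℤ) (m : ℕ) : Set ℝ := {x | p < x * 2 ^ m ∧ x * 2 ^ m < p + 1}

theorem isOpen_dyadicIoo (p : ℤ) (m : ℕ) : IsOpen (dyadicIoo p m) := by
  have h : Continuous fun x : ℝ => x * 2 ^ m := by fun_prop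
  exact (isOpen_lt continuous_const h).inter (isOpen_lt h continuous_const)

theorem nonempty_dyadicIoo (p : ℤ) (m : ℕ) : (dyadicIoo p m).Nonempty := by
  refine ⟨(p + 1 / 2) / 2 ^ m, ?_⟩
  have : ((p : ℝ) + 1 / 2) / 2 ^ m * 2 ^ m = p + 1 / 2 := by field_simp
  simp only [dyadicIoo, Set.mem_ofPred_eq, this]
  constructor <;> linarith

theorem binDigit_eq_of_mem_dyadicIoo {x : ℝ} {p : ℤ} {m : ℕ} (hx : x ∈ dyadicIoo p m) :
    binDigit x m = p % 2 := by
  rw [binDigit, Int.floor_eq_iff.2 ⟨hx.1.le, hx.2⟩]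

/-- Every nonempty open set contains a dyadic interval. -/
theorem exists_dyadicIoo_subset {U : Set ℝ} (hU : IsOpen U) (hne : U.Nonempty) :
    ∃ p m, dyadicIoo p m ⊆ U := by
  obtain ⟨x, hx⟩ := hne
  obtain ⟨ε, hε, hball⟩ := Metric.isOpen_iff.1 hU x hx
  obtain ⟨m, hm⟩ := exists_pow_lt_of_lt_one hε (by norm_num : (1 / 2 : ℝ) < 1)
  refine ⟨⌊x * 2 ^ m⌋, m, fun y hy => hball ?_⟩
  have h1 := Int.floor_le (x * 2 ^ m)
  have h2 := Int.lt_floor_add_one (x * 2 ^ m)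
  have h3 : |(y - x) * 2 ^ m| < 1 := by
    rw [abs_lt]
    constructor <;> nlinarith [hy.1, hy.2]
  rw [Metric.mem_ball, Real.dist_eq]
  rw [abs_mul, abs_of_pos (by positivity : (0 : ℝ) < 2 ^ m)] at h3
  refine lt_trans ?_ hm
  rwa [one_div, inv_pow, ← one_div, lt_div_iff₀ (by positivity)]

/-- Digits beyond those fixed by a dyadic interval can be prescribed on a smaller one. -/
theorem exists_dyadicIoo_subset_binDigit (w : ℕ → ℤ) (hw : ∀ j, w j = 0 ∨ w j = 1)
    (p : ℤ) (m L : ℕ) :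
    ∃ q, dyadicIoo q (m + L) ⊆ dyadicIoo p m ∧
      ∀ x ∈ dyadicIoo q (m + L), ∀ j, m < j → j ≤ m + L → binDigit x j = w j := by
  induction L with
  | zero => exact ⟨p, subset_rfl, fun x _ j h1 h2 => by omega⟩
  | succ L ih =>
    obtain ⟨q, hsub, hq⟩ := ih
    have hstep : dyadicIoo (2 * q + w (m + (L + 1))) (m + (L + 1)) ⊆ dyadicIoo q (m + L) := by
      rintro x ⟨h1, h2⟩
      rw [← add_assoc, pow_succ] at h1 h2
      push_cast at h1 h2
      rcases hw (m + L + 1) with h | h <;> rw [h] at h1 h2 <;> push_cast at h1 h2 <;>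
        constructor <;> linarith
    refine ⟨_, hstep.trans hsub, fun x hx j h1 h2 => ?_⟩
    rcases Nat.lt_or_ge (m + L) j with h | h
    · obtain rfl : j = m + (L + 1) := by omega
      rw [binDigit_eq_of_mem_dyadicIoo hx]
      rcases hw (m + (L + 1)) with h | h <;> rw [h] <;> omega
    · exact hq x (hstep hx) j h1 h

/-- On a subinterval, `decodeReal` can be made to agree with `g` on any finite range of sufficiently
large indices. -/
theorem exists_dyadicIoo_subset_decodeReal (g : ℕ → ℕ) (p : ℤ) (m N : ℕ) :
    ∃ q l, dyadicIoo q l ⊆ dyadicIoo p m ∧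
      ∀ x ∈ dyadicIoo q l, ∀ n, m < n → n < N → decodeReal x n = g n := by
  -- Row `n` of `w` has its only `1` in column `g n`.
  set w : ℕ → ℤ := fun j => if j.unpair.2 = g j.unpair.1 then 1 else 0 with hwdef
  have hw : ∀ j, w j = 0 ∨ w j = 1 := fun j => by
    simp only [hwdef]; split_ifs <;> simp
  set L := (Finset.range N).sup fun n => Nat.pair n (g n)
  obtain ⟨q, hsub, hq⟩ := exists_dyadicIoo_subset_binDigit w hw p m L
  refine ⟨q, m + L, hsub, fun x hx n hmn hnN => ?_⟩
  have hL : Nat.pair n (g n) ≤ L :=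
    Finset.le_sup (f := fun n => Nat.pair n (g n)) (Finset.mem_range.2 hnN)
  have hdig : ∀ k ≤ g n, binDigit x (Nat.pair n k) = if k = g n then 1 else 0 := by
    intro k hk
    have h1 : Nat.pair n k ≤ Nat.pair n (g n) := by
      rcases hk.lt_or_eq with h | h
      · exact (Nat.pair_lt_pair_right n h).le
      · rw [h]
    -- Row `n` lies at positions `≥ n > m`, beyond the digits already fixed.
    rw [hq x hx _ (hmn.trans_le (Nat.left_le_pair n k)) (by omega)]
    simp [hwdef]
  have hmem : g n ∈ {k | binDigit x (Nat.pair n k) = 1} := by simp [hdig _ le_rfl]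
  refine le_antisymm (Nat.sInf_le hmem) (le_of_not_gt fun hlt => ?_)
  have h := Nat.sInf_mem ⟨_, hmem⟩
  change binDigit x (Nat.pair n (decodeReal x n)) = 1 at h
  rw [hdig _ hlt.le, if_neg hlt.ne] at h
  exact zero_ne_one h

/-- For each `f`, the reals whose decoded sequence matches `f` infinitely often are comeagre. -/
theorem infinite_extendsFin_decodeReal_mem_residual (f : ℕ → (Σ n : ℕ, (Fin n → ℕ))) :
    {x : ℝ | {i | ExtendsFin (fun n => decodeReal x (i + n)) (f i)}.Infinite} ∈ residual ℝ := by
  -- The interior supplies openness: `decodeReal` is not continuous.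
  set G : ℕ → Set ℝ := fun N => interior
    {x | ∃ i > N, ExtendsFin (fun n => decodeReal x (i + n)) (f i)}
  have hdense : ∀ N, Dense (G N) := by
    intro N
    rw [dense_iff_inter_open]
    intro U hU hne
    obtain ⟨p, m, hpm⟩ := exists_dyadicIoo_subset hU hne
    set i := max m N + 1
    obtain ⟨q, l, hsub, hq⟩ := exists_dyadicIoo_subset_decodeReal
      (fun n => if h : n - i < (f i).1 then (f i).2 ⟨n - i, h⟩ else 0) p m (i + (f i).1)
    obtain ⟨x, hx⟩ := nonempty_dyadicIoo q l
    refine ⟨x, hpm (hsub hx), mem_interior.2 ⟨_, fun y hy => ?_, isOpen_dyadicIoo q l, hx⟩⟩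
    refine ⟨i, by omega, fun k => ?_⟩
    have hk := k.2
    change decodeReal y (i + k) = _
    rw [hq y hy _ (by omega) (by omega)]
    simp
  refine Filter.mem_of_superset (countable_iInter_mem.2 fun N =>
    residual_of_dense_open isOpen_interior (hdense N)) fun x hx => ?_
  rw [Set.mem_ofPred_eq, Set.infinite_iff_exists_gt]
  intro N
  obtain ⟨i, hi, h⟩ := interior_subset (Set.mem_iInter.1 hx N)
  exact ⟨i, h, hi⟩

theorem propertyStar_image_decodeReal {S : Set ℝ} (hS : ¬ IsMeagre S) :
    PropertyStar (decodeReal '' S) := by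
  intro f
  by_contra! h
  refine hS (Filter.mem_of_superset (infinite_extendsFin_decodeReal_mem_residual f) ?_)
  intro x hx hxS
  exact hx (h _ ⟨x, hxS, rfl⟩)

/-- Preimages under `Real.ofDigits` of dense sets meet every cylinder. -/
theorem Dense.exists_ofDigits_mem {D : Set ℝ} (hD : Dense D) (s : ℕ → Fin 2) (n : ℕ) :
    ∃ y : ℕ → Fin 2, (∀ k < n, y k = s k) ∧ Real.ofDigits y ∈ D := by
  set r := ∑ i ∈ Finset.range n, Real.ofDigitsTerm s i
  obtain ⟨x, ⟨hx1, hx2⟩, hxD⟩ := (dense_iff_inter_open.1 hD) (Set.Ioo r (r + (2 ^ n)⁻¹)) isOpen_Ioo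
    (Set.nonempty_Ioo.2 (by simp))
  obtain ⟨t, -, ht⟩ := Real.ofDigits_SurjOn (b := 2) one_lt_two
    (show (x - r) * 2 ^ n ∈ Set.Icc (0 : ℝ) 1 by
      constructor
      · exact mul_nonneg (by linarith) (by positivity)
      · rw [← le_div_iff₀ (by positivity), one_div]
        linarith)
  refine ⟨fun i => if i < n then s i else t (i - n), fun k hk => if_pos hk, ?_⟩
  rw [Real.ofDigits_eq_sum_add_ofDigits _ n]
  have h1 : ∑ i ∈ Finset.range n,
      Real.ofDigitsTerm (fun i => if i < n then s i else t (i - n)) i = r := by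
    refine Finset.sum_congr rfl fun i hi => ?_
    simp [Real.ofDigitsTerm, Finset.mem_range.1 hi]
  have h2 : (fun i => (fun i => if i < n then s i else t (i - n)) (i + n)) = t := by
    funext i; simp
  rw [h1, h2, ht]
  convert hxD using 1
  push_cast
  field_simp
  ring

/-- A single finite word forces a given dense open set, whatever the preceding `n` digits. -/
theorem exists_forcing_word {D : Set ℝ} (hDo : IsOpen D) (hD : Dense D) (n : ℕ) :
    ∃ (L : ℕ) (t : ℕ → Fin 2), ∀ a : ℕ → Fin 2, (∀ k < L, a (n + k) = t k) →
      Real.ofDigits a ∈ D := by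
  -- Treat the prefixes one at a time: lengthening the word keeps what it already forces.
  suffices h : ∀ F : Finset (Fin n → Fin 2), ∃ (L : ℕ) (t : ℕ → Fin 2), ∀ a : ℕ → Fin 2,
      (fun i : Fin n => a i) ∈ F → (∀ k < L, a (n + k) = t k) → Real.ofDigits a ∈ D by
    obtain ⟨L, t, h⟩ := h Finset.univ
    exact ⟨L, t, fun a => h a (Finset.mem_univ _)⟩
  intro F
  induction F using Finset.induction_on with
  | empty => exact ⟨0, 0, fun a ha => by simp at ha⟩
  | insert s F _ ih =>
    obtain ⟨L, t, ht⟩ := ih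
    obtain ⟨y, hy, hyD⟩ := hD.exists_ofDigits_mem
      (fun i => if h : i < n then s ⟨i, h⟩ else t (i - n)) (n + L)
    obtain ⟨ε, hε, hball⟩ := Metric.isOpen_iff.1 hDo _ hyD
    obtain ⟨m, hm⟩ := exists_pow_lt_of_lt_one hε (by norm_num : (1 / 2 : ℝ) < 1)
    -- Length `L` keeps the old word; length `m` keeps the real within `ε` of `Real.ofDigits y`.
    refine ⟨max L m, fun k => y (n + k), fun a ha hak => ?_⟩
    rcases Finset.mem_insert.1 ha with h | h
    · refine hball ?_
      rw [Metric.mem_ball, Real.dist_eq]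
      refine (Real.abs_ofDigits_sub_ofDigits_le (n := m) fun i hi => ?_).trans_lt (by simpa using hm)
      rcases Nat.lt_or_ge i n with hin | hin
      · rw [hy i (by omega), dif_pos hin, ← h]
      · obtain ⟨k, rfl⟩ := Nat.exists_eq_add_of_le hin
        exact hak k (lt_max_of_lt_right (by omega))
    · refine ht a h fun k hk => ?_
      rw [hak k (lt_max_of_lt_left hk)]
      change y (n + k) = t k
      rw [hy _ (by omega), dif_neg (by omega)]
      simp

/-- The real number whose binary digits are the parities of the entries of `a`. -/
noncomputable def parityReal (a : ℕ → ℕ) : ℝ := Real.ofDigits fun n => Fin.ofNat 2 (a n)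

theorem PropertyStar.not_isMeagre_image_parityReal {S : Set (ℕ → ℕ)} (hS : PropertyStar S) :
    ¬ IsMeagre (parityReal '' S) := by
  intro hM
  obtain ⟨T, hTS, hTG, hTd⟩ := mem_residual.1 hM
  obtain ⟨U, hUo, rfl⟩ := hTG.eq_iInter_nat
  have hopen : ∀ n, IsOpen (⋂ i ∈ Finset.range (n + 1), U i) := fun n =>
    isOpen_biInter_finset fun i _ => hUo i
  have hdense : ∀ n, Dense (⋂ i ∈ Finset.range (n + 1), U i) := fun n =>
    hTd.mono (Set.subset_iInter₂ fun i _ => Set.iInter_subset U i)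
  choose L t ht using fun n => exists_forcing_word (hopen n) (hdense n) n
  obtain ⟨a, haS, ha⟩ := hS fun i => ⟨L i, fun k => (t i k : ℕ)⟩
  refine hTS (Set.mem_iInter.2 fun n => ?_) ⟨a, haS, rfl⟩
  obtain ⟨i, hi, hni⟩ := ha.exists_gt n
  have := ht i (fun n => Fin.ofNat 2 (a n)) fun k hk => by
    have h := hi ⟨k, hk⟩
    simp only at h
    ext
    simp only [Fin.ofNat, h]
    exact Nat.mod_eq_of_lt (t i k).2
  exact Set.mem_iInter₂.1 this n (Finset.mem_range.2 (by omega))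

theorem mainTheorem6 :
    IsLeast {c : Cardinal.{0} | ∃ S : Set (ℕ → ℕ), PropertyStar S ∧ #S = c} nonM := by
  have hle : ∀ S : Set (ℕ → ℕ), PropertyStar S → nonM ≤ #S := fun S hS =>
    (nonM_isLeast.2 ⟨_, hS.not_isMeagre_image_parityReal, rfl⟩).trans Cardinal.mk_image_le
  refine ⟨?_, ?_⟩
  · obtain ⟨S, hS, hcard⟩ := nonM_isLeast.1
    have hstar := propertyStar_image_decodeReal hS
    exact ⟨_, hstar, le_antisymm (Cardinal.mk_image_le.trans hcard.le) (hle _ hstar)⟩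
  · rintro c ⟨S, hS, rfl⟩
    exact hle S hS
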